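/- Let $K$ be a field, let $\mathcal C$ be a $K$-linear abelian category and let $F:\mathcal C\to \mathrm{Vec}_K^{<\infty}$ be an exact, faithful $K$-linear functor to finite-dimensional $K$-vector spaces. Let $$\mathrm{End}^\vee(F)=\int^{X\in\mathcal C} F(X)\otimes_K F(X)^*$$ be the coend in $K$-vector spaces, i.e. the quotient of $\bigoplus_X F(X)\otimes F(X)^*$ by the relations $x\otimes F(f)^*\varphi\sim F(f)x\otimes\varphi$ for $f:X\to Y$, $x\in F(X)$, $\varphi\in F(Y)^*$, and write $[x\otimes\varphi]$ for the class of $x\otimes\varphi$. It is a $K$-coalgebra with $$\Delta[x\otimes\varphi]=\sum_i [x\otimes w_i^*]\otimes[w_i\otimes\varphi],\qquad \varepsilon[x\otimes\varphi]=\varphi(x),$$ where $(w_i)$ is any basis of $F(X)$ and $(w_i^*)$ its dual basis. Each $F(X)$ is a finite-dimensional left $\mathrm{End}^\vee(F)$-comodule through the coevaluation $$\eta_X:F(X)\to \mathrm{End}^\vee(F)\otimes F(X),\qquad \eta_X(x)=\sum_i [x\otimes w_i^*]\otimes w_i .$$ Then the lift $$\widetilde F:\mathcal C\to \mathrm{Comod}_{<\infty}(\mathrm{End}^\vee(F)),\qquad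 X\mapsto (F(X),\eta_X),\quad f\mapsto F(f),$$ of $F$ to the category of finite-dimensional left $\mathrm{End}^\vee(F)$-comodules is an equivalence of categories. -/

import Mathlib

open CategoryTheory TensorProduct

universe t u v w

/-! ### Finite-dimensional left comodules over a coalgebra -/

/-- A finite-dimensional left comodule over a `K`-coalgebra `E`: a finite-dimensional vector space
`V` with a linear map `V → E ⊗ V` compatible with the comultiplication and with the counit. -/
structure FDComod (K : Type u) [Field K] (E : Type w) [AddCommGroup E] [Module K E]
    [Coalgebra K E] where
  /-- the underlying finite-dimensional vector space -/
  space : FGModuleCat.{t} K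
  /-- the coaction -/
  coact : space →ₗ[K] E ⊗[K] space
  coassoc : LinearMap.lTensor E coact ∘ₗ coact =
    (TensorProduct.assoc K E E space).toLinearMap ∘ₗ
      LinearMap.rTensor space (Coalgebra.comul (R := K) (A := E)) ∘ₗ coact
  counit_coact : LinearMap.rTensor space (Coalgebra.counit (R := K) (A := E)) ∘ₗ coact =
    (TensorProduct.lid K space).symm.toLinearMap

namespace FDComod

variable {K : Type u} [Field K] {E : Type w} [AddCommGroup E] [Module K E] [Coalgebra K E]

/-- A morphism of comodules: a linear map that commutes with the coactions. -/
@[ext]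
structure Hom (V W : FDComod.{t} K E) where
  /-- the underlying linear map -/
  map : V.space ⟶ W.space
  comm : W.coact ∘ₗ map.hom.hom = LinearMap.lTensor E map.hom.hom ∘ₗ V.coact

/-- The category of finite-dimensional left comodules. -/
instance category : Category (FDComod.{t} K E) where
  Hom V W := Hom V W
  id V :=
    { map := 𝟙 V.space
      comm := by simp }
  comp {U V W} f g :=
    { map := f.map ≫ g.map
      comm := by
        rw [FGModuleCat.hom_hom_comp, ← LinearMap.comp_assoc, g.comm, LinearMap.comp_assoc, f.comm,
          ← LinearMap.comp_assoc, ← LinearMap.lTensor_comp] }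
  id_comp f := Hom.ext (Category.id_comp f.map)
  comp_id f := Hom.ext (Category.comp_id f.map)
  assoc f g h := Hom.ext (Category.assoc f.map g.map h.map)

variable (K E) in
/-- The forgetful functor to finite-dimensional vector spaces. -/
def forget : FDComod.{t} K E ⥤ FGModuleCat.{t} K where
  obj V := V.space
  map f := f.map

end FDComod

/-! ### The coalgebra `End^∨(F)` -/

namespace EndDual

variable {K : Type u} [Field K] {C : Type w} [Category.{v} C] (F : C ⥤ FGModuleCat.{t} K)

/-- The linear map underlying `F(f)`. -/
abbrev lin {X Y : C} (f : X ⟶ Y) : F.obj X →ₗ[K] F.obj Y := (F.map f).hom.hom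

/-- The space `⨁_X F(X) ⊗ F(X)^*`. -/
abbrev Total : Type (max t u w) :=
  DirectSum C fun X => (F.obj X : Type t) ⊗[K] Module.Dual K (F.obj X)

open Classical in
/-- The inclusion of the summand at `X`. -/
noncomputable def incl (X : C) : (F.obj X) ⊗[K] Module.Dual K (F.obj X) →ₗ[K] Total F :=
  DirectSum.lof K C (fun X => (F.obj X : Type t) ⊗[K] Module.Dual K (F.obj X)) X

/-- The span of the relations `x ⊗ F(f)^* φ ∼ F(f) x ⊗ φ`, for `f : X ⟶ Y`, `x ∈ F(X)` and
`φ ∈ F(Y)^*`. -/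
def relations : Submodule K (Total F) :=
  Submodule.span K {z | ∃ (X Y : C) (f : X ⟶ Y) (x : F.obj X) (φ : Module.Dual K (F.obj Y)),
    z = incl F X (x ⊗ₜ (lin F f).dualMap φ) - incl F Y (lin F f x ⊗ₜ φ)}

end EndDual

/-- The coend `End^∨(F) = ∫^X F(X) ⊗ F(X)^*` in `K`-vector spaces; its universal property is
proved in `EndDual.existsUnique_desc`. -/
abbrev EndDual {K : Type u} [Field K] {C : Type w} [Category.{v} C] (F : C ⥤ FGModuleCat.{t} K) :
    Type (max t u w) :=
  EndDual.Total F ⧸ EndDual.relations F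

namespace EndDual

variable {K : Type u} [Field K] {C : Type w} [Category.{v} C] (F : C ⥤ FGModuleCat.{t} K)

/-- The structure map `λ_X : F(X) ⊗ F(X)^* → End^∨(F)` of the coend. -/
noncomputable def ι (X : C) : (F.obj X) ⊗[K] Module.Dual K (F.obj X) →ₗ[K] EndDual F :=
  (relations F).mkQ ∘ₗ incl F X

theorem ι_dinatural {X Y : C} (f : X ⟶ Y) (x : F.obj X) (φ : Module.Dual K (F.obj Y)) :
    ι F X (x ⊗ₜ (lin F f).dualMap φ) = ι F Y (lin F f x ⊗ₜ φ) := by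
  simp only [ι, LinearMap.comp_apply, Submodule.mkQ_apply]
  rw [Submodule.Quotient.eq]
  exact Submodule.subset_span ⟨X, Y, f, x, φ, rfl⟩

variable {F} in
theorem hom_ext {M : Type*} [AddCommGroup M] [Module K M] {g h : EndDual F →ₗ[K] M}
    (H : ∀ (X : C) (x : F.obj X) (φ : Module.Dual K (F.obj X)),
      g (ι F X (x ⊗ₜ φ)) = h (ι F X (x ⊗ₜ φ))) : g = h := by
  classical
  apply Submodule.linearMap_qext
  apply DirectSum.linearMap_ext
  intro X
  apply TensorProduct.ext'
  intro x φ
  have := H X x φ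
  simp only [ι, incl, LinearMap.comp_apply] at this
  simp only [LinearMap.comp_apply]
  convert this

open Classical in
variable {F} in
/-- The map out of the coend induced by a dinatural family. -/
noncomputable def desc {M : Type*} [AddCommGroup M] [Module K M]
    (a : ∀ X : C, (F.obj X) ⊗[K] Module.Dual K (F.obj X) →ₗ[K] M)
    (ha : ∀ (X Y : C) (f : X ⟶ Y) (x : F.obj X) (φ : Module.Dual K (F.obj Y)),
      a X (x ⊗ₜ (lin F f).dualMap φ) = a Y (lin F f x ⊗ₜ φ)) : EndDual F →ₗ[K] M :=
  (relations F).liftQ (DirectSum.toModule K C M a) (by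
    refine Submodule.span_le.2 ?_
    rintro _ ⟨X, Y, f, x, φ, rfl⟩
    simp only [SetLike.mem_coe, LinearMap.mem_ker, map_sub, incl]
    rw [DirectSum.toModule_lof, DirectSum.toModule_lof, ha, sub_self])

variable {F} in
@[simp]
theorem desc_ι {M : Type*} [AddCommGroup M] [Module K M]
    (a : ∀ X : C, (F.obj X) ⊗[K] Module.Dual K (F.obj X) →ₗ[K] M)
    (ha : ∀ (X Y : C) (f : X ⟶ Y) (x : F.obj X) (φ : Module.Dual K (F.obj Y)),
      a X (x ⊗ₜ (lin F f).dualMap φ) = a Y (lin F f x ⊗ₜ φ))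
    (X : C) (z : (F.obj X) ⊗[K] Module.Dual K (F.obj X)) : desc a ha (ι F X z) = a X z := by
  classical
  exact DirectSum.toModule_lof
    (M := fun X => (F.obj X : Type t) ⊗[K] Module.Dual K (F.obj X)) K X z

variable {F} in
/-- The universal property of the coend. -/
theorem existsUnique_desc {M : Type*} [AddCommGroup M] [Module K M]
    (a : ∀ X : C, (F.obj X) ⊗[K] Module.Dual K (F.obj X) →ₗ[K] M)
    (ha : ∀ (X Y : C) (f : X ⟶ Y) (x : F.obj X) (φ : Module.Dual K (F.obj Y)),
      a X (x ⊗ₜ (lin F f).dualMap φ) = a Y (lin F f x ⊗ₜ φ)) :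
    ∃! g : EndDual F →ₗ[K] M, ∀ X, g ∘ₗ ι F X = a X := by
  refine ⟨desc a ha, fun X => LinearMap.ext fun z => desc_ι a ha X z, fun g hg => hom_ext ?_⟩
  intro X x φ
  rw [desc_ι, ← hg X, LinearMap.comp_apply]

/-- The unit `1 ↦ ∑ᵢ wᵢ^* ⊗ wᵢ` of the duality between `F(X)` and `F(X)^*`. -/
noncomputable def unitElem (X : C) : Module.Dual K (F.obj X) ⊗[K] (F.obj X) :=
  TensorProduct.comm K (F.obj X) (Module.Dual K (F.obj X)) (coevaluation K (F.obj X) 1)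

/-- The coevaluation `η_X : F(X) → F(X) ⊗ F(X)^* ⊗ F(X) → End^∨(F) ⊗ F(X)`. -/
noncomputable def coev (X : C) : F.obj X →ₗ[K] EndDual F ⊗[K] (F.obj X) :=
  LinearMap.rTensor (F.obj X) (ι F X) ∘ₗ
    (TensorProduct.assoc K (F.obj X) (Module.Dual K (F.obj X)) (F.obj X)).symm.toLinearMap ∘ₗ
      (TensorProduct.mk K (F.obj X) (Module.Dual K (F.obj X) ⊗[K] (F.obj X))).flip (unitElem F X)

/-- The component `F(X) ⊗ F(X)^* → F(X) ⊗ F(X)^* ⊗ F(X) ⊗ F(X)^* → End^∨(F) ⊗ End^∨(F)` of the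
comultiplication. -/
noncomputable def comulAux (X : C) :
    (F.obj X) ⊗[K] Module.Dual K (F.obj X) →ₗ[K] EndDual F ⊗[K] EndDual F :=
  LinearMap.lTensor (EndDual F) (ι F X) ∘ₗ
    (TensorProduct.assoc K (EndDual F) (F.obj X) (Module.Dual K (F.obj X))).toLinearMap ∘ₗ
      LinearMap.rTensor (Module.Dual K (F.obj X)) (coev F X)

/-- The basis `(wᵢ)` of `F(X)` used in `coevaluation`. -/
noncomputable abbrev bas (X : C) := Module.Basis.ofVectorSpace K (F.obj X)

theorem coev_apply (X : C) (x : F.obj X) :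
    coev F X x = ∑ i, ι F X (x ⊗ₜ (bas F X).coord i) ⊗ₜ[K] bas F X i := by
  simp [coev, unitElem, coevaluation_apply_one, map_sum]

theorem comulAux_tmul (X : C) (x : F.obj X) (φ : Module.Dual K (F.obj X)) :
    comulAux F X (x ⊗ₜ φ) =
      ∑ i, ι F X (x ⊗ₜ (bas F X).coord i) ⊗ₜ[K] ι F X (bas F X i ⊗ₜ φ) := by
  simp [comulAux, coev_apply, sum_tmul, map_sum]

theorem coev_naturality {X Y : C} (f : X ⟶ Y) (x : F.obj X) :
    coev F Y (lin F f x) = LinearMap.lTensor (EndDual F) (lin F f) (coev F X x) := by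
  simp only [coev_apply, map_sum, LinearMap.lTensor_tmul, ← ι_dinatural]
  have h1 : ∀ j, (lin F f).dualMap ((bas F Y).coord j) =
      ∑ i, ((bas F Y).coord j (lin F f (bas F X i))) • (bas F X).coord i := by
    intro j
    refine (bas F X).ext fun k => ?_
    classical
    simp [Finsupp.single_apply, -Module.Basis.coe_ofVectorSpace]
  have h2 : ∀ i, lin F f (bas F X i) =
      ∑ j, ((bas F Y).coord j (lin F f (bas F X i))) • bas F Y j := fun i =>
    ((bas F Y).sum_repr _).symm
  simp only [h1, tmul_sum, map_sum, sum_tmul, tmul_smul, map_smul]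
  rw [Finset.sum_comm]
  refine Finset.sum_congr rfl fun i _ => ?_
  conv_rhs => rw [h2 i]
  simp only [tmul_sum, tmul_smul, smul_tmul']

theorem comulAux_dinatural (X Y : C) (f : X ⟶ Y) (x : F.obj X) (φ : Module.Dual K (F.obj Y)) :
    comulAux F X (x ⊗ₜ (lin F f).dualMap φ) = comulAux F Y (lin F f x ⊗ₜ φ) := by
  have h := congrArg
    (LinearMap.lTensor (EndDual F) (ι F Y ∘ₗ (TensorProduct.mk K _ _).flip φ))
    (coev_naturality F f x)
  simp only [coev_apply, map_sum, LinearMap.lTensor_tmul, LinearMap.comp_apply,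
    LinearMap.flip_apply, TensorProduct.mk_apply] at h
  simp only [comulAux_tmul, ι_dinatural]
  exact h.symm

theorem contract_dinatural (X Y : C) (f : X ⟶ Y) (x : F.obj X) (φ : Module.Dual K (F.obj Y)) :
    contractRight K (F.obj X) (x ⊗ₜ (lin F f).dualMap φ) =
      contractRight K (F.obj Y) (lin F f x ⊗ₜ φ) := by
  simp

/-- `Δ [x ⊗ φ] = ∑ᵢ [x ⊗ wᵢ^*] ⊗ [wᵢ ⊗ φ]` and `ε [x ⊗ φ] = φ x`. -/
noncomputable instance coalgebraStruct : CoalgebraStruct K (EndDual F) where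
  comul := desc (comulAux F) (comulAux_dinatural F)
  counit := desc (fun X => contractRight K (F.obj X)) (contract_dinatural F)

theorem comul_ι (X : C) (x : F.obj X) (φ : Module.Dual K (F.obj X)) :
    Coalgebra.comul (R := K) (ι F X (x ⊗ₜ φ)) =
      ∑ i, ι F X (x ⊗ₜ (bas F X).coord i) ⊗ₜ[K] ι F X (bas F X i ⊗ₜ φ) :=
  (desc_ι _ (comulAux_dinatural F) X _).trans (comulAux_tmul F X x φ)

theorem counit_ι (X : C) (x : F.obj X) (φ : Module.Dual K (F.obj X)) :
    Coalgebra.counit (R := K) (ι F X (x ⊗ₜ φ)) = φ x :=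
  (desc_ι _ (contract_dinatural F) X _).trans (contractRight_apply _ _)

theorem sum_coord_smul (X : C) (φ : Module.Dual K (F.obj X)) :
    ∑ i, φ (bas F X i) • (bas F X).coord i = φ := by
  refine (bas F X).ext fun k => ?_
  simp [-Module.Basis.coe_ofVectorSpace]

/-- `End^∨(F)` is a coalgebra. -/
noncomputable instance coalgebra : Coalgebra K (EndDual F) where
  coassoc := by
    apply hom_ext
    intro X x φ
    simp only [LinearMap.comp_apply, comul_ι, map_sum, LinearMap.rTensor_tmul,
      LinearMap.lTensor_tmul, sum_tmul, tmul_sum, LinearEquiv.coe_coe, TensorProduct.assoc_tmul]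
    exact Finset.sum_comm
  rTensor_counit_comp_comul := by
    apply hom_ext
    intro X x φ
    simp only [LinearMap.comp_apply, comul_ι, map_sum, LinearMap.rTensor_tmul, counit_ι,
      TensorProduct.mk_apply]
    have : ∀ i, (bas F X).coord i x ⊗ₜ[K] ι F X (bas F X i ⊗ₜ φ) =
        (1 : K) ⊗ₜ[K] ι F X (((bas F X).coord i x • bas F X i) ⊗ₜ φ) := by
      intro i
      rw [← smul_tmul', map_smul, ← smul_tmul, smul_eq_mul, mul_one]
    simp only [this, ← tmul_sum, ← map_sum, ← sum_tmul]
    congr 3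
    exact (bas F X).sum_repr x
  lTensor_counit_comp_comul := by
    apply hom_ext
    intro X x φ
    simp only [LinearMap.comp_apply, comul_ι, map_sum, LinearMap.lTensor_tmul, counit_ι,
      TensorProduct.mk_apply, LinearMap.flip_apply]
    have : ∀ i, ι F X (x ⊗ₜ (bas F X).coord i) ⊗ₜ[K] φ (bas F X i) =
        ι F X (x ⊗ₜ (φ (bas F X i) • (bas F X).coord i)) ⊗ₜ[K] (1 : K) := by
      intro i
      rw [tmul_smul, map_smul, smul_tmul, smul_eq_mul, mul_one]
    simp only [this, ← sum_tmul, ← map_sum, ← tmul_sum, sum_coord_smul]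

/-- The left `End^∨(F)`-comodule `(F(X), η_X)`. -/
noncomputable def liftObj (X : C) : FDComod.{t} K (EndDual F) where
  space := F.obj X
  coact := coev F X
  coassoc := by
    ext x
    simp only [LinearMap.comp_apply, coev_apply, map_sum, LinearMap.lTensor_tmul,
      LinearMap.rTensor_tmul, comul_ι, sum_tmul, tmul_sum, LinearEquiv.coe_coe,
      TensorProduct.assoc_tmul]
    exact Finset.sum_comm
  counit_coact := by
    ext x
    simp only [LinearMap.comp_apply, coev_apply, map_sum, LinearMap.rTensor_tmul, counit_ι,
      LinearEquiv.coe_coe, TensorProduct.lid_symm_apply]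
    have : ∀ i, (bas F X).coord i x ⊗ₜ[K] bas F X i =
        (1 : K) ⊗ₜ[K] ((bas F X).coord i x • bas F X i) := by
      intro i
      rw [← smul_tmul, smul_eq_mul, mul_one]
    simp only [this, ← tmul_sum]
    congr 1
    exact (bas F X).sum_repr x

/-- The lift `F̃ : C ⥤ Comod_{<∞}(End^∨(F))` of `F`, equal to `F` on morphisms. -/
noncomputable def lift : C ⥤ FDComod.{t} K (EndDual F) where
  obj X := liftObj F X
  map f :=
    { map := F.map f
      comm := LinearMap.ext fun x => coev_naturality F f x }
  map_id X := FDComod.Hom.ext (F.map_id X)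
  map_comp f g := FDComod.Hom.ext (F.map_comp f g)

theorem lift_comp_forget : lift F ⋙ FDComod.forget K (EndDual F) = F := rfl

end EndDual

/-! For `b : F(Z) → W`, the map `coevWith F b : F(Z) → End^∨(F) ⊗ W` is a comodule map into the
cofree comodule on `W`. Everything rests on its kernel when `W` is finite-dimensional: `coevWith F b
z = 0` forces `z` to come from some `G ⟶ Z` along which `b` vanishes (`exists_of_coevWith_eq_zero`).
Such morphisms can be added up, so the kernel is `F` of a subobject of `Z`
(`exists_range_eq_ker_coevWith`).

To see the vanishing, one object `G` with one element `y ∈ F(G)` is made to generate the fibres of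
all objects occurring in a relation. Each relation then becomes a morphism out of `G` that kills
`y`, and exactness moves `y` into its kernel (`exists_evalAlong_eq_zero`).

Fullness: the graph of a comodule map is such a kernel, hence comes from a subobject of `X ⊞ Y`, and
`F` reflects isomorphisms. Essential surjectivity: the coaction of `V` lands in the image of some
`coevWith F b`. Dividing out its kernel makes this map injective, so `V` embeds into some `F(Q)`. A
subcomodule of `F(Q)` is again such a kernel, for the quotient map of `F(Q)` by it. -/

namespace EndDual

/-! ### Functoriality and linearity of `F` on underlying linear maps. -/

section Lin

variable {K : Type u} [Field K] {C : Type w} [Category.{v} C] (F : C ⥤ FGModuleCat.{t} K)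

theorem lin_id (X : C) : lin F (𝟙 X) = LinearMap.id := by
  rw [lin, F.map_id, FGModuleCat.hom_hom_id]

theorem lin_comp {X Y Z : C} (f : X ⟶ Y) (g : Y ⟶ Z) : lin F (f ≫ g) = lin F g ∘ₗ lin F f := by
  rw [lin, F.map_comp, FGModuleCat.hom_hom_comp]

theorem lin_comp_apply {X Y Z : C} (f : X ⟶ Y) (g : Y ⟶ Z) (x : F.obj X) :
    lin F (f ≫ g) x = lin F g (lin F f x) := by
  rw [lin_comp, LinearMap.comp_apply]

theorem lin_add [Preadditive C] [F.Additive] {X Y : C} (f g : X ⟶ Y) :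
    lin F (f + g) = lin F f + lin F g := by
  rw [lin, F.map_add]; rfl

theorem lin_zero [Preadditive C] [F.Additive] (X Y : C) : lin F (0 : X ⟶ Y) = 0 := by
  rw [lin, F.map_zero]; rfl

theorem lin_smul [Preadditive C] [Linear K C] [F.Linear K] {X Y : C} (c : K) (f : X ⟶ Y) :
    lin F (c • f) = c • lin F f := by
  rw [lin, F.map_smul]; rfl

/-- `F` on morphisms, as a linear map. -/
def linHom [Preadditive C] [Linear K C] [F.Additive] [F.Linear K] (X Y : C) :
    (X ⟶ Y) →ₗ[K] (F.obj X →ₗ[K] F.obj Y) where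
  toFun f := lin F f
  map_add' := lin_add F
  map_smul' := lin_smul F

/-- Faithful functors reflect monomorphisms and epimorphisms, and an abelian category is balanced.
-/
theorem isIso_of_lin_bijective [Abelian C] [F.Faithful] {X Y : C} (f : X ⟶ Y)
    (hf : Function.Bijective (lin F f)) : IsIso f := by
  have h1 : Mono f := by
    apply F.mono_of_mono_map
    refine ⟨fun g h hgh => ?_⟩
    ext x
    exact hf.1 (congrArg (fun k => k.hom.hom x) hgh)
  have h2 : Epi f := by
    apply F.epi_of_epi_map
    refine ⟨fun g h hgh => ?_⟩
    ext y
    obtain ⟨x, rfl⟩ := hf.2 y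
    exact congrArg (fun k => k.hom.hom x) hgh
  exact isIso_of_mono_of_epi f

end Lin

/-! ### Exactness in terms of elements of the fibres. -/

section Exact

variable {K : Type u} [Field K] {C : Type w} [Category.{v} C] [Abelian C]
  (F : C ⥤ FGModuleCat.{t} K) [F.Additive]
    [Limits.PreservesFiniteLimits F] [Limits.PreservesFiniteColimits F]

theorem exists_lin_eq_of_exact {S : ShortComplex C} (hS : S.Exact) (y : F.obj S.X₂)
    (hy : lin F S.g y = 0) : ∃ x : F.obj S.X₁, lin F S.f x = y := by
  have h := hS.map (F ⋙ forget₂ (FGModuleCat.{t} K) (ModuleCat.{t} K))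
  rw [ShortComplex.moduleCat_exact_iff] at h
  exact h y hy

theorem exists_lin_kernel_ι {X Y : C} (f : X ⟶ Y) (x : F.obj X) (hx : lin F f x = 0) :
    ∃ z, lin F (Limits.kernel.ι f) z = x :=
  exists_lin_eq_of_exact F (S := ShortComplex.mk _ f (Limits.kernel.condition f))
    (ShortComplex.exact_kernel f) x hx

theorem exists_lin_of_lin_cokernel_π {X Y : C} (f : X ⟶ Y) (y : F.obj Y)
    (hy : lin F (Limits.cokernel.π f) y = 0) : ∃ x, lin F f x = y :=
  exists_lin_eq_of_exact F (S := ShortComplex.mk f _ (Limits.cokernel.condition f))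
    (ShortComplex.exact_cokernel f) y hy

theorem lin_surjective {X Y : C} (f : X ⟶ Y) [Epi f] : Function.Surjective (lin F f) := by
  have : Epi ((F ⋙ forget₂ (FGModuleCat.{t} K) (ModuleCat.{t} K)).map f) := inferInstance
  exact (ModuleCat.epi_iff_surjective _).1 this

theorem lin_injective {X Y : C} (f : X ⟶ Y) [Mono f] : Function.Injective (lin F f) := by
  have : Mono ((F ⋙ forget₂ (FGModuleCat.{t} K) (ModuleCat.{t} K)).map f) := inferInstance
  exact (ModuleCat.mono_iff_injective _).1 this

/-- The fibre product, built as the kernel of `f₁ - f₂` on `G₁ ⊞ G₂`; by exactness `(y₁, y₂)` lifts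
to it. This lets two vanishing conditions be imposed simultaneously. -/
theorem exists_common_refinement {G₁ G₂ Z : C} (f₁ : G₁ ⟶ Z) (f₂ : G₂ ⟶ Z) (y₁ : F.obj G₁)
    (y₂ : F.obj G₂) (h : lin F f₁ y₁ = lin F f₂ y₂) :
    ∃ (G : C) (g₁ : G ⟶ G₁) (g₂ : G ⟶ G₂) (y : F.obj G), g₁ ≫ f₁ = g₂ ≫ f₂ ∧
      lin F g₁ y = y₁ ∧ lin F g₂ y = y₂ := by
  let d : G₁ ⊞ G₂ ⟶ Z := Limits.biprod.fst ≫ f₁ - Limits.biprod.snd ≫ f₂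
  let y : F.obj (G₁ ⊞ G₂) := lin F Limits.biprod.inl y₁ + lin F Limits.biprod.inr y₂
  have h1 : lin F Limits.biprod.fst y = y₁ := by
    rw [map_add, ← lin_comp_apply, ← lin_comp_apply, Limits.biprod.inl_fst,
      Limits.biprod.inr_fst, lin_id, lin_zero]
    simp
  have h2 : lin F Limits.biprod.snd y = y₂ := by
    rw [map_add, ← lin_comp_apply, ← lin_comp_apply, Limits.biprod.inl_snd,
      Limits.biprod.inr_snd, lin_id, lin_zero]
    simp
  have h3 : lin F d y = 0 := by
    have hs : lin F (d + Limits.biprod.snd ≫ f₂) y = lin F (Limits.biprod.fst ≫ f₁) y := by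
      rw [sub_add_cancel]
    rw [lin_add, LinearMap.add_apply, lin_comp_apply, lin_comp_apply, h1, h2, h] at hs
    simpa using hs
  obtain ⟨z, hz⟩ := exists_lin_kernel_ι F d y h3
  refine ⟨_, Limits.kernel.ι d ≫ Limits.biprod.fst, Limits.kernel.ι d ≫ Limits.biprod.snd, z,
    ?_, ?_, ?_⟩
  · have := Limits.kernel.condition d
    rw [Preadditive.comp_sub, sub_eq_zero] at this
    simpa using this
  · rw [lin_comp_apply, hz, h1]
  · rw [lin_comp_apply, hz, h2]

end Exact

/-! ### When a class in the coend vanishes. -/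

section Null

variable {K : Type u} [Field K] {C : Type w} [Category.{v} C] [Abelian C]
  [Linear K C] (F : C ⥤ FGModuleCat.{t} K) [F.Additive] [F.Linear K]

open Classical ZeroObject in
/-- Every finite set of objects `X` admits an object `G` with an element `y ∈ F(G)` such that each
element of `F(X)` is the image of `y` under a morphism `G ⟶ X` that depends linearly on it. -/
theorem exists_generating_element (s : Finset C) :
    ∃ (G : C) (y : F.obj G) (p : ∀ X : C, F.obj X →ₗ[K] (G ⟶ X)),
      ∀ X ∈ s, ∀ x : F.obj X, lin F (p X x) y = x := by
  induction s using Finset.induction_on with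
  | empty => exact ⟨0, 0, fun X => 0, by simp⟩
  | insert Y s hY ih =>
    obtain ⟨G, y, p, hp⟩ := ih
    have := Abelian.hasFiniteBiproducts (C := C)
    -- One copy of `Y` per basis vector; `e` is the tuple of all basis vectors, so linear
    -- combinations of the projections send it to any prescribed element of `F(Y)`.
    let B : C := ⨁ fun _ : Module.Basis.ofVectorSpaceIndex K (F.obj Y) => Y
    let e : F.obj B := ∑ j, lin F (Limits.biproduct.ι _ j) (bas F Y j)
    have he : ∀ i, lin F (Limits.biproduct.π _ i) e = bas F Y i := by
      intro i
      simp only [e, map_sum, ← lin_comp_apply]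
      rw [Finset.sum_eq_single i]
      · rw [Limits.biproduct.ι_π_self, lin_id, LinearMap.id_apply]
      · intro j _ hj
        rw [Limits.biproduct.ι_π_ne _ hj, lin_zero, LinearMap.zero_apply]
      · simp
    let q : F.obj Y →ₗ[K] (B ⟶ Y) := ∑ i, ((bas F Y).coord i).smulRight (Limits.biproduct.π _ i)
    have hq : ∀ x, lin F (q x) e = x := by
      intro x
      change linHom F B Y (q x) e = x
      simp only [q, LinearMap.sum_apply, map_sum, LinearMap.smulRight_apply, map_smul,
        LinearMap.smul_apply]
      exact (Finset.sum_congr rfl fun i _ => congrArg _ (he i)).trans ((bas F Y).sum_repr x)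
    let y' : F.obj (G ⊞ B) := lin F Limits.biprod.inl y + lin F Limits.biprod.inr e
    have h1 : lin F Limits.biprod.fst y' = y := by
      rw [map_add, ← lin_comp_apply, ← lin_comp_apply, Limits.biprod.inl_fst,
        Limits.biprod.inr_fst, lin_id, lin_zero]
      simp
    have h2 : lin F Limits.biprod.snd y' = e := by
      rw [map_add, ← lin_comp_apply, ← lin_comp_apply, Limits.biprod.inl_snd,
        Limits.biprod.inr_snd, lin_id, lin_zero]
      simp
    let p' : ∀ X : C, F.obj X →ₗ[K] (G ⊞ B ⟶ X) :=
      Function.update (fun X => Linear.leftComp K X Limits.biprod.fst ∘ₗ p X) Y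
        (Linear.leftComp K Y Limits.biprod.snd ∘ₗ q)
    refine ⟨G ⊞ B, y', p', fun X hX x => ?_⟩
    by_cases hXY : X = Y
    · subst hXY
      simp only [p', Function.update_self, LinearMap.comp_apply, Linear.leftComp_apply]
      rw [lin_comp_apply, h2, hq]
    · simp only [p', Function.update_of_ne hXY, LinearMap.comp_apply, Linear.leftComp_apply]
      rw [lin_comp_apply, h1, hp X ((Finset.mem_insert.1 hX).resolve_left hXY)]

open Classical in
/-- The map `⨁_X F(X) ⊗ F(X)^* → F(G)^*`, `x ⊗ φ ↦ φ ∘ F(p_X(x))`. -/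
noncomputable def evalAlong {G : C} (p : ∀ X : C, F.obj X →ₗ[K] (G ⟶ X)) :
    Total F →ₗ[K] Module.Dual K (F.obj G) :=
  DirectSum.toModule K C _ fun X => TensorProduct.lift
    ((LinearMap.llcomp K (F.obj G) (F.obj X) K).flip ∘ₗ linHom F G X ∘ₗ p X)

theorem evalAlong_incl {G : C} (p : ∀ X : C, F.obj X →ₗ[K] (G ⟶ X)) (X : C) (x : F.obj X)
    (φ : Module.Dual K (F.obj X)) :
    evalAlong F p (incl F X (x ⊗ₜ φ)) = φ ∘ₗ lin F (p X x) := by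
  classical
  refine (DirectSum.toModule_lof
    (M := fun X => (F.obj X : Type t) ⊗[K] Module.Dual K (F.obj X)) K X _).trans ?_
  rfl

variable [Limits.PreservesFiniteLimits F] [Limits.PreservesFiniteColimits F]

open Classical in
-- For a generating relation along `f`, the value of `evalAlong` is `φ` composed with `F` of `p X x
-- ≫ f - p Y (F(f) x)`. This morphism kills `y`, so its kernel contains a lift of `y` and serves as
-- `G'`. Sums are handled by a common refinement.
theorem exists_evalAlong_eq_zero {r : Total F} (hr : r ∈ relations F) :
    ∃ s : Finset C, ∀ (G : C) (y : F.obj G) (p : ∀ X : C, F.obj X →ₗ[K] (G ⟶ X)),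
      (∀ X ∈ s, ∀ x : F.obj X, lin F (p X x) y = x) →
        ∃ (G' : C) (g : G' ⟶ G) (y' : F.obj G'), lin F g y' = y ∧
          evalAlong F p r ∘ₗ lin F g = 0 := by
  induction hr using Submodule.span_induction with
  | mem r hr =>
    obtain ⟨X, Y, f, x, φ, rfl⟩ := hr
    refine ⟨{X, Y}, fun G y p hp => ?_⟩
    have hX : lin F (p X x ≫ f) y = lin F (p Y (lin F f x)) y := by
      rw [lin_comp_apply, hp X (by simp), hp Y (by simp)]
    have h0 : lin F (p X x ≫ f - p Y (lin F f x)) y = 0 := by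
      have h : linHom F G Y (p X x ≫ f - p Y (lin F f x)) =
        linHom F G Y (p X x ≫ f) - linHom F G Y (p Y (lin F f x)) := map_sub _ _ _
      exact (congrArg (fun l => l y) h).trans (sub_eq_zero.2 hX)
    obtain ⟨z, hz⟩ := exists_lin_kernel_ι F _ y h0
    refine ⟨_, _, z, hz, ?_⟩
    have hk := Limits.kernel.condition (p X x ≫ f - p Y (lin F f x))
    rw [Preadditive.comp_sub, sub_eq_zero] at hk
    rw [map_sub, evalAlong_incl, evalAlong_incl, LinearMap.sub_comp, sub_eq_zero]
    change φ ∘ₗ (lin F f ∘ₗ lin F (p X x)) ∘ₗ _ = φ ∘ₗ _ ∘ₗ _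
    rw [← lin_comp, ← lin_comp, ← lin_comp, hk]
  | zero => exact ⟨∅, fun G y p _ => ⟨G, 𝟙 G, y, by rw [lin_id]; rfl, by simp⟩⟩
  | add r₁ r₂ _ _ h₁ h₂ =>
    obtain ⟨s₁, h₁⟩ := h₁
    obtain ⟨s₂, h₂⟩ := h₂
    refine ⟨s₁ ∪ s₂, fun G y p hp => ?_⟩
    obtain ⟨G₁, g₁, y₁, e₁, k₁⟩ := h₁ G y p fun X hX => hp X (by simp [hX])
    obtain ⟨G₂, g₂, y₂, e₂, k₂⟩ := h₂ G y p fun X hX => hp X (by simp [hX])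
    obtain ⟨G', a₁, a₂, y', ha, b₁, b₂⟩ :=
      exists_common_refinement F g₁ g₂ y₁ y₂ (e₁.trans e₂.symm)
    refine ⟨G', a₁ ≫ g₁, y', by rw [lin_comp_apply, b₁, e₁], ?_⟩
    rw [map_add, LinearMap.add_comp]
    nth_rewrite 2 [ha]
    rw [lin_comp, lin_comp, ← LinearMap.comp_assoc, ← LinearMap.comp_assoc, k₁, k₂]
    simp
  | smul c r _ h =>
    obtain ⟨s, h⟩ := h
    refine ⟨s, fun G y p hp => ?_⟩
    obtain ⟨G', g, y', e, k⟩ := h G y p hp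
    exact ⟨G', g, y', e, by rw [map_smul, LinearMap.smul_comp, k, smul_zero]⟩

/-- If `[z ⊗ φ] = 0`, then `z` comes from an object over `Z` on which `φ` vanishes. -/
theorem exists_of_ι_eq_zero {Z : C} {z : F.obj Z} {φ : Module.Dual K (F.obj Z)}
    (h : ι F Z (z ⊗ₜ φ) = 0) :
    ∃ (G : C) (g : G ⟶ Z) (y : F.obj G), lin F g y = z ∧ φ ∘ₗ lin F g = 0 := by
  classical
  have hr : incl F Z (z ⊗ₜ φ) ∈ relations F := (Submodule.Quotient.mk_eq_zero _).1 h
  obtain ⟨s, hs⟩ := exists_evalAlong_eq_zero F hr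
  -- `Z` is added so that `p Z z` carries `y` to `z`; then `evalAlong` of `z ⊗ φ` is `φ ∘ F(p Z z)`,
  -- which dies on `G'`.
  obtain ⟨G, y, p, hp⟩ := exists_generating_element F (insert Z s)
  obtain ⟨G', g, y', e, k⟩ := hs G y p fun X hX => hp X (Finset.mem_insert_of_mem hX)
  refine ⟨G', g ≫ p Z z, y', ?_, ?_⟩
  · rw [lin_comp_apply, e, hp Z (Finset.mem_insert_self _ _)]
  · rw [lin_comp, ← LinearMap.comp_assoc, ← evalAlong_incl, k]

open Classical in
theorem exists_of_forall_ι_eq_zero {Z : C} {z : F.obj Z} (s : Finset (Module.Dual K (F.obj Z)))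
    (h : ∀ φ ∈ s, ι F Z (z ⊗ₜ φ) = 0) :
    ∃ (G : C) (g : G ⟶ Z) (y : F.obj G), lin F g y = z ∧ ∀ φ ∈ s, φ ∘ₗ lin F g = 0 := by
  induction s using Finset.induction_on with
  | empty => exact ⟨Z, 𝟙 Z, z, by rw [lin_id]; rfl, by simp⟩
  | insert ψ s _ ih =>
    obtain ⟨G₁, g₁, y₁, e₁, k₁⟩ := ih fun φ hφ => h φ (Finset.mem_insert_of_mem hφ)
    obtain ⟨G₂, g₂, y₂, e₂, k₂⟩ := exists_of_ι_eq_zero F (h ψ (Finset.mem_insert_self _ _))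
    obtain ⟨G, a₁, a₂, y, ha, b₁, b₂⟩ :=
      exists_common_refinement F g₁ g₂ y₁ y₂ (e₁.trans e₂.symm)
    refine ⟨G, a₁ ≫ g₁, y, by rw [lin_comp_apply, b₁, e₁], fun φ hφ => ?_⟩
    obtain rfl | hφ := Finset.mem_insert.1 hφ
    · rw [ha, lin_comp, ← LinearMap.comp_assoc, k₂, LinearMap.zero_comp]
    · rw [lin_comp, ← LinearMap.comp_assoc, k₁ φ hφ, LinearMap.zero_comp]

end Null

end EndDual

namespace EndDual

/-! ### Comodule maps from `F(Z)` to cofree comodules. -/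

section CoevWith

variable {K : Type u} [Field K] {C : Type w} [Category.{v} C] (F : C ⥤ FGModuleCat.{t} K)
  {W : Type*} [AddCommGroup W] [Module K W]

/-- The map `F(Z) → End^∨(F) ⊗ W`, `z ↦ ∑ᵢ [z ⊗ wᵢ^*] ⊗ b(wᵢ)` induced by `b : F(Z) → W`. -/
noncomputable def coevWith {Z : C} (b : F.obj Z →ₗ[K] W) : F.obj Z →ₗ[K] EndDual F ⊗[K] W :=
  LinearMap.lTensor (EndDual F) b ∘ₗ coev F Z

theorem coevWith_lin {Y Z : C} (b : F.obj Z →ₗ[K] W) (f : Y ⟶ Z) (y : F.obj Y) :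
    coevWith F b (lin F f y) = coevWith F (b ∘ₗ lin F f) y := by
  rw [coevWith, LinearMap.comp_apply, coev_naturality, coevWith, LinearMap.lTensor_comp]
  rfl

theorem lTensor_coevWith {W' : Type*} [AddCommGroup W'] [Module K W'] {Z : C}
    (b : F.obj Z →ₗ[K] W) (c : W →ₗ[K] W') (z : F.obj Z) :
    LinearMap.lTensor (EndDual F) c (coevWith F b z) = coevWith F (c ∘ₗ b) z := by
  rw [coevWith, coevWith, LinearMap.lTensor_comp]
  rfl

theorem coevWith_add {Z : C} (b c : F.obj Z →ₗ[K] W) :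
    coevWith F (b + c) = coevWith F b + coevWith F c := by
  rw [coevWith, LinearMap.lTensor_add, LinearMap.add_comp]
  rfl

theorem coevWith_zero (Z : C) : coevWith F (0 : F.obj Z →ₗ[K] W) = 0 := by
  rw [coevWith, LinearMap.lTensor_zero, LinearMap.zero_comp]

theorem rid_coevWith {Z : C} (φ : Module.Dual K (F.obj Z)) (z : F.obj Z) :
    TensorProduct.rid K (EndDual F) (coevWith F φ z) = ι F Z (z ⊗ₜ φ) := by
  conv_rhs => rw [← sum_coord_smul F Z φ]
  simp only [coevWith, LinearMap.comp_apply, coev_apply, map_sum, LinearMap.lTensor_tmul,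
    TensorProduct.rid_tmul, tmul_sum, tmul_smul, map_smul]

theorem coevWith_smulRight {Z : C} (φ : Module.Dual K (F.obj Z)) (w : W) (z : F.obj Z) :
    coevWith F (φ.smulRight w) z = ι F Z (z ⊗ₜ φ) ⊗ₜ w := by
  conv_rhs => rw [← sum_coord_smul F Z φ]
  simp only [coevWith, LinearMap.comp_apply, coev_apply, map_sum, LinearMap.lTensor_tmul,
    LinearMap.smulRight_apply, tmul_sum, tmul_smul, map_smul, sum_tmul]
  simp only [smul_tmul']

theorem counit_coevWith {Z : C} (b : F.obj Z →ₗ[K] W) (z : F.obj Z) :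
    LinearMap.rTensor W (Coalgebra.counit (R := K) (A := EndDual F)) (coevWith F b z) =
      1 ⊗ₜ b z := by
  have h := LinearMap.congr_fun (liftObj F Z).counit_coact z
  have h' := congrArg (LinearMap.lTensor K b) h
  rw [coevWith, LinearMap.comp_apply, ← LinearMap.comp_apply (LinearMap.rTensor _ _),
    LinearMap.rTensor_comp_lTensor, ← LinearMap.lTensor_comp_rTensor]
  exact h'

/-- The counit recovers `b z`. -/
theorem eq_zero_of_coevWith_eq_zero {Z : C} {b : F.obj Z →ₗ[K] W} {z : F.obj Z}
    (h : coevWith F b z = 0) : b z = 0 := by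
  have := counit_coevWith F b z
  rw [h, map_zero] at this
  simpa using (congrArg (TensorProduct.lid K W) this).symm

/-- This is the compatibility of `coevWith F b` with the coaction `Δ ⊗ W` of the cofree comodule. -/
theorem lTensor_coevWith_coev {Z : C} (b : F.obj Z →ₗ[K] W) (z : F.obj Z) :
    LinearMap.lTensor (EndDual F) (coevWith F b) (coev F Z z) =
      TensorProduct.assoc K (EndDual F) (EndDual F) W
        (LinearMap.rTensor W (Coalgebra.comul (R := K) (A := EndDual F)) (coevWith F b z)) := by
  simp only [coevWith, LinearMap.comp_apply, coev_apply, map_sum, LinearMap.lTensor_tmul,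
      LinearMap.rTensor_tmul, comul_ι, sum_tmul, tmul_sum, TensorProduct.assoc_tmul]
  exact Finset.sum_comm

end CoevWith

/-! ### Images and kernels of the maps `coevWith F b`. -/

section Abelian

variable {K : Type u} [Field K] {C : Type w} [Category.{v} C] [Abelian C]
  [Linear K C] (F : C ⥤ FGModuleCat.{t} K) [F.Additive] [F.Linear K]
  {W : Type*} [AddCommGroup W] [Module K W]

open ZeroObject in
omit [Linear K C] [F.Linear K] in
-- A tensor `[y ⊗ φ] ⊗ x` comes from the rank-one map `φ.smulRight x`, and sums are absorbed by
-- passing to `Z₁ ⊞ Z₂`.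
theorem exists_coevWith_eq (e : EndDual F ⊗[K] W) :
    ∃ (Z : C) (b : F.obj Z →ₗ[K] W) (z : F.obj Z), coevWith F b z = e := by
  classical
  have h0 : ∃ (Z : C) (b : F.obj Z →ₗ[K] W) (z : F.obj Z), coevWith F b z = 0 :=
    ⟨0, 0, 0, map_zero _⟩
  have hadd : ∀ e₁ e₂ : EndDual F ⊗[K] W,
      (∃ (Z : C) (b : F.obj Z →ₗ[K] W) (z : F.obj Z), coevWith F b z = e₁) →
      (∃ (Z : C) (b : F.obj Z →ₗ[K] W) (z : F.obj Z), coevWith F b z = e₂) →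
      ∃ (Z : C) (b : F.obj Z →ₗ[K] W) (z : F.obj Z), coevWith F b z = e₁ + e₂ := by
    rintro _ _ ⟨Z₁, b₁, z₁, rfl⟩ ⟨Z₂, b₂, z₂, rfl⟩
    let z : F.obj (Z₁ ⊞ Z₂) := lin F Limits.biprod.inl z₁ + lin F Limits.biprod.inr z₂
    refine ⟨Z₁ ⊞ Z₂, b₁ ∘ₗ lin F Limits.biprod.fst + b₂ ∘ₗ lin F Limits.biprod.snd, z, ?_⟩
    rw [coevWith_add, LinearMap.add_apply, ← coevWith_lin, ← coevWith_lin]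
    simp only [z, map_add, ← lin_comp_apply, Limits.biprod.inl_fst, Limits.biprod.inr_fst,
      Limits.biprod.inl_snd, Limits.biprod.inr_snd, lin_id, lin_zero, LinearMap.id_apply,
      LinearMap.zero_apply, add_zero, zero_add]
  induction e using TensorProduct.induction_on with
  | zero => exact h0
  | add e₁ e₂ h₁ h₂ => exact hadd e₁ e₂ h₁ h₂
  | tmul e x =>
    obtain ⟨r, rfl⟩ := Submodule.mkQ_surjective _ e
    induction r using DirectSum.induction_on with
    | zero => rw [map_zero, zero_tmul]; exact h0
    | add r₁ r₂ h₁ h₂ => rw [map_add, add_tmul]; exact hadd _ _ h₁ h₂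
    | of X a =>
      change ∃ (Z : C) (b : F.obj Z →ₗ[K] W) (z : F.obj Z), coevWith F b z =
        (relations F).mkQ (DirectSum.lof K C
          (fun X => (F.obj X : Type t) ⊗[K] Module.Dual K (F.obj X)) X a) ⊗ₜ[K] x
      have ha : (relations F).mkQ (DirectSum.lof K C
          (fun X => (F.obj X : Type t) ⊗[K] Module.Dual K (F.obj X)) X a) = ι F X a := by
        simp only [ι, incl, LinearMap.comp_apply]
      rw [ha]
      induction a using TensorProduct.induction_on with
      | zero => rw [map_zero, zero_tmul]; exact h0
      | add a₁ a₂ h₁ h₂ =>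
        rw [map_add, add_tmul]
        exact hadd _ _ (h₁ (by simp only [ι, incl, LinearMap.comp_apply]))
          (h₂ (by simp only [ι, incl, LinearMap.comp_apply]))
      | tmul y φ => exact ⟨X, _, y, coevWith_smulRight F φ x y⟩

omit [Linear K C] [F.Linear K] in
theorem exists_range_le_range_coevWith {V : Type*} [AddCommGroup V] [Module K V]
    [Module.Finite K V] (ρ : V →ₗ[K] EndDual F ⊗[K] W) :
    ∃ (Z : C) (b : F.obj Z →ₗ[K] W), LinearMap.range ρ ≤ LinearMap.range (coevWith F b) := by
  classical
  have := Abelian.hasFiniteBiproducts (C := C)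
  let B := Module.finBasis K V
  choose Z b z hz using fun i => exists_coevWith_eq F (ρ (B i))
  let d : F.obj (⨁ Z) →ₗ[K] W := ∑ i, b i ∘ₗ lin F (Limits.biproduct.π Z i)
  have hd : ∀ i, d ∘ₗ lin F (Limits.biproduct.ι Z i) = b i := by
    intro i
    ext x
    simp only [d, LinearMap.comp_apply, LinearMap.sum_apply, ← lin_comp_apply]
    rw [Finset.sum_eq_single i]
    · rw [Limits.biproduct.ι_π_self, lin_id, LinearMap.id_apply]
    · intro j _ hj
      rw [Limits.biproduct.ι_π_ne _ hj.symm, lin_zero, LinearMap.zero_apply, map_zero]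
    · simp
  refine ⟨⨁ Z, d, ?_⟩
  rw [LinearMap.range_eq_map, ← B.span_eq, Submodule.map_span_le]
  rintro _ ⟨i, rfl⟩
  exact ⟨lin F (Limits.biproduct.ι Z i) (z i), by rw [coevWith_lin, hd, hz]⟩

variable [Limits.PreservesFiniteLimits F] [Limits.PreservesFiniteColimits F]

/-- Coordinates on `W` reduce this to finitely many classes `[z ⊗ φ]`. -/
theorem exists_of_coevWith_eq_zero [Module.Finite K W] {Z : C} {b : F.obj Z →ₗ[K] W} {z : F.obj Z}
    (h : coevWith F b z = 0) :
    ∃ (G : C) (g : G ⟶ Z) (y : F.obj G), lin F g y = z ∧ b ∘ₗ lin F g = 0 := by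
  classical
  let B := Module.finBasis K W
  obtain ⟨G, g, y, e, k⟩ := exists_of_forall_ι_eq_zero F
    (Finset.univ.image fun i => B.coord i ∘ₗ b) (z := z) (by
      intro φ hφ
      obtain ⟨i, _, rfl⟩ := Finset.mem_image.1 hφ
      rw [← rid_coevWith, ← lTensor_coevWith, h, map_zero, map_zero])
  refine ⟨G, g, y, e, LinearMap.ext fun x => B.ext_elem fun i => ?_⟩
  have := LinearMap.congr_fun (k (B.coord i ∘ₗ b) (Finset.mem_image_of_mem _ (Finset.mem_univ i))) x
  simpa using this

omit [Linear K C] [F.Linear K] in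
-- Replaces `f` by the monomorphism from its image.
theorem range_lin_kernel_ι_cokernel_π {X Y : C} (f : X ⟶ Y) :
    LinearMap.range (lin F (Limits.kernel.ι (Limits.cokernel.π f))) =
      LinearMap.range (lin F f) := by
  apply le_antisymm
  · rintro _ ⟨x, rfl⟩
    refine exists_lin_of_lin_cokernel_π F f _ ?_
    rw [← lin_comp_apply, Limits.kernel.condition, lin_zero, LinearMap.zero_apply]
  · rintro _ ⟨x, rfl⟩
    refine exists_lin_kernel_ι F _ _ ?_
    rw [← lin_comp_apply, Limits.cokernel.condition, lin_zero, LinearMap.zero_apply]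

/-- The kernel of `F(Z) → End^∨(F) ⊗ W` comes from a subobject of `Z`. -/
theorem exists_range_eq_ker_coevWith [Module.Finite K W] {Z : C} (b : F.obj Z →ₗ[K] W) :
    ∃ (I : C) (i : I ⟶ Z), Mono i ∧ LinearMap.range (lin F i) = LinearMap.ker (coevWith F b) := by
  classical
  have := Abelian.hasFiniteBiproducts (C := C)
  let B := Module.finBasis K (LinearMap.ker (coevWith F b))
  choose G g y hy hb using fun i => exists_of_coevWith_eq_zero F (LinearMap.mem_ker.1 (B i).2)
  -- The `G i` reach a basis of the kernel, and `b` vanishes along each `g i`. So `F(d)` has range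
  -- exactly the kernel, and the image of `d` is the subobject sought.
  let d : (⨁ G) ⟶ Z := Limits.biproduct.desc g
  have hker : LinearMap.ker (coevWith F b) ≤ LinearMap.range (lin F d) := by
    suffices h : ⊤ ≤ (LinearMap.range (lin F d)).comap (LinearMap.ker (coevWith F b)).subtype from
      fun x hx => h (Submodule.mem_top (x := ⟨x, hx⟩))
    rw [← B.span_eq, Submodule.span_le]
    rintro _ ⟨i, rfl⟩
    refine ⟨lin F (Limits.biproduct.ι G i) (y i), ?_⟩
    rw [← lin_comp_apply, Limits.biproduct.ι_desc, hy]
    rfl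
  have hbd : b ∘ₗ lin F d = 0 := by
    have hs : d = ∑ i, Limits.biproduct.π G i ≫ g i := by
      simp [d, Limits.biproduct.desc_eq]
    have hl : lin F d = ∑ i, lin F (Limits.biproduct.π G i ≫ g i) := by
      rw [hs]; exact map_sum (linHom F (⨁ G) Z) _ _
    ext x
    simp only [hl, LinearMap.comp_apply, LinearMap.sum_apply, map_sum, lin_comp_apply]
    exact Finset.sum_eq_zero fun i _ => LinearMap.congr_fun (hb i) _
  have hrange : LinearMap.range (lin F d) ≤ LinearMap.ker (coevWith F b) := by
    rintro _ ⟨x, rfl⟩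
    rw [LinearMap.mem_ker, coevWith_lin, hbd, coevWith_zero, LinearMap.zero_apply]
  exact ⟨_, Limits.kernel.ι (Limits.cokernel.π d), inferInstance,
    (range_lin_kernel_ι_cokernel_π F d).trans (le_antisymm hrange hker)⟩

end Abelian

end EndDual

/-! ### Generalities on comodules. -/

namespace FDComod

variable {K : Type u} [Field K] {E : Type w} [AddCommGroup E] [Module K E] [Coalgebra K E]

/-- A linear equivalence that commutes with the coactions is an isomorphism of comodules. -/
def isoOfLinearEquiv {V W : FDComod.{t} K E} (e : V.space ≃ₗ[K] W.space)
    (he : W.coact ∘ₗ e.toLinearMap = LinearMap.lTensor E e.toLinearMap ∘ₗ V.coact) : V ≅ W where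
  hom := ⟨FGModuleCat.ofHom e.toLinearMap, he⟩
  inv := ⟨FGModuleCat.ofHom e.symm.toLinearMap, by
    change V.coact ∘ₗ e.symm.toLinearMap = LinearMap.lTensor E e.symm.toLinearMap ∘ₗ W.coact
    have h : W.coact = LinearMap.lTensor E e.toLinearMap ∘ₗ V.coact ∘ₗ e.symm.toLinearMap := by
      rw [← LinearMap.comp_assoc, ← he, LinearMap.comp_assoc, LinearEquiv.comp_symm,
        LinearMap.comp_id]
    rw [h, ← LinearMap.comp_assoc, ← LinearMap.lTensor_comp, LinearEquiv.symm_comp,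
      LinearMap.lTensor_id, LinearMap.id_comp]⟩
  hom_inv_id := Hom.ext (FGModuleCat.hom_ext (LinearMap.ext e.symm_apply_apply))
  inv_hom_id := Hom.ext (FGModuleCat.hom_ext (LinearMap.ext e.apply_symm_apply))

theorem coact_injective (V : FDComod.{t} K E) : Function.Injective V.coact := by
  refine Function.Injective.of_comp
    (f := LinearMap.rTensor V.space (Coalgebra.counit (R := K) (A := E))) ?_
  rw [← LinearMap.coe_comp, V.counit_coact]
  exact (TensorProduct.lid K V.space).symm.injective

end FDComod

/-! ### Fullness and essential surjectivity of the lift. -/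

namespace EndDual

variable {K : Type u} [Field K] {C : Type w} [Category.{v} C] [Abelian C]
  [Linear K C] (F : C ⥤ FGModuleCat.{t} K) [F.Additive] [F.Linear K]
  [Limits.PreservesFiniteLimits F] [Limits.PreservesFiniteColimits F]

omit [Abelian C] [Linear K C] [F.Additive] [F.Linear K] [Limits.PreservesFiniteLimits F]
  [Limits.PreservesFiniteColimits F] in
theorem coev_injective (X : C) : Function.Injective (coev F X) :=
  (liftObj F X).coact_injective

/-- A morphism of comodules `F(X) → F(Y)` comes from a morphism `X ⟶ Y`: its graph comes from a
subobject of `X ⊞ Y`. -/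
theorem exists_lin_eq_of_coev_comp [F.Faithful] {X Y : C} (l : F.obj X →ₗ[K] F.obj Y)
    (hl : coev F Y ∘ₗ l = LinearMap.lTensor (EndDual F) l ∘ₗ coev F X) :
    ∃ f : X ⟶ Y, lin F f = l := by
  -- The kernel of `(x, y) ↦ y - l x` is the graph of `l`.
  let b : F.obj (X ⊞ Y) →ₗ[K] F.obj Y := lin F Limits.biprod.snd - l ∘ₗ lin F Limits.biprod.fst
  -- As `l` is a comodule map, so is `b`; since `coev F Y` is injective, `coevWith F b` has the same
  -- kernel as `b`.
  have hb : coevWith F b = coev F Y ∘ₗ b := by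
    ext z
    have h1 := LinearMap.congr_fun hl (lin F Limits.biprod.fst z)
    simp only [LinearMap.comp_apply] at h1
    simp only [b, coevWith, LinearMap.lTensor_sub, LinearMap.comp_apply, LinearMap.sub_apply,
      map_sub, LinearMap.lTensor_comp, ← coev_naturality, h1]
  obtain ⟨I, i, _, hi⟩ := exists_range_eq_ker_coevWith F b
  have hi' : ∀ z, (∃ x, lin F i x = z) ↔ b z = 0 := by
    intro z
    rw [← LinearMap.mem_range, hi, LinearMap.mem_ker, hb, LinearMap.comp_apply,
      map_eq_zero_iff _ (coev_injective F Y)]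
  let c := Limits.cokernel.π i
  have hc : ∀ z, lin F c z = 0 ↔ b z = 0 := by
    intro z
    rw [← hi']
    refine ⟨fun h => exists_lin_of_lin_cokernel_π F i z h, ?_⟩
    rintro ⟨x, rfl⟩
    rw [← lin_comp_apply, Limits.cokernel.condition, lin_zero, LinearMap.zero_apply]
  have hinl : ∀ x, b (lin F Limits.biprod.inl x) = - l x := by
    intro x
    simp only [b, LinearMap.sub_apply, LinearMap.comp_apply, ← lin_comp_apply,
      Limits.biprod.inl_fst, Limits.biprod.inl_snd, lin_id, lin_zero, LinearMap.id_apply,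
      LinearMap.zero_apply, zero_sub]
  have hinr : ∀ y, b (lin F Limits.biprod.inr y) = y := by
    intro y
    simp only [b, LinearMap.sub_apply, LinearMap.comp_apply, ← lin_comp_apply,
      Limits.biprod.inr_fst, Limits.biprod.inr_snd, lin_id, lin_zero, LinearMap.id_apply,
      LinearMap.zero_apply, map_zero, sub_zero]
  have hcb : ∀ z, lin F (Limits.biprod.inr ≫ c) (b z) = lin F c z := by
    intro z
    rw [lin_comp_apply, ← sub_eq_zero, ← map_sub, hc, map_sub, hinr, sub_self]
  -- The quotient of `X ⊞ Y` by the graph is identified with `Y`, the quotient map becoming `b`. On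
  -- `X` it is `-l`, whence the sign in the witness below.
  have : IsIso (Limits.biprod.inr ≫ c) := by
    refine isIso_of_lin_bijective F _ ⟨?_, fun q => ?_⟩
    · rw [injective_iff_map_eq_zero]
      intro y hy
      rwa [lin_comp_apply, hc, hinr] at hy
    · obtain ⟨z, rfl⟩ := lin_surjective F c q
      exact ⟨b z, hcb z⟩
  refine ⟨-(Limits.biprod.inl ≫ c ≫ inv (Limits.biprod.inr ≫ c)), ?_⟩
  ext x
  have hneg : lin F (-(Limits.biprod.inl ≫ c ≫ inv (Limits.biprod.inr ≫ c))) =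
      -lin F (Limits.biprod.inl ≫ c ≫ inv (Limits.biprod.inr ≫ c)) :=
    map_neg (linHom F X Y) _
  rw [hneg, LinearMap.neg_apply, lin_comp_apply, lin_comp_apply, ← hcb, ← lin_comp_apply,
    IsIso.hom_inv_id, lin_id, LinearMap.id_apply, hinl, neg_neg]

/-- `Q` is the quotient of `Z` by the subobject giving the kernel. By the counit `b` vanishes on
that kernel, so it descends to `F(Q)` without changing the range. -/
theorem exists_coevWith_injective {V W : Type*} [AddCommGroup V] [Module K V] [Module.Finite K V]
    [AddCommGroup W] [Module K W] [Module.Finite K W] (ρ : V →ₗ[K] EndDual F ⊗[K] W) :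
    ∃ (Q : C) (b : F.obj Q →ₗ[K] W), Function.Injective (coevWith F b) ∧
      LinearMap.range ρ ≤ LinearMap.range (coevWith F b) := by
  obtain ⟨Z, b, hb⟩ := exists_range_le_range_coevWith F ρ
  obtain ⟨I, i, _, hi⟩ := exists_range_eq_ker_coevWith F b
  let c := Limits.cokernel.π i
  obtain ⟨s, hs⟩ := (lin F c).exists_rightInverse_of_surjective
    (LinearMap.range_eq_top.2 (lin_surjective F c))
  have hker : ∀ z, lin F c z = 0 → coevWith F b z = 0 := by
    intro z hz
    rw [← LinearMap.mem_ker, ← hi]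
    exact exists_lin_of_lin_cokernel_π F i z hz
  have hbs : (b ∘ₗ s) ∘ₗ lin F c = b := by
    ext z
    rw [LinearMap.comp_apply, LinearMap.comp_apply, ← sub_eq_zero, ← map_sub]
    refine eq_zero_of_coevWith_eq_zero F (hker _ ?_)
    have := LinearMap.congr_fun hs (lin F c z)
    rw [LinearMap.comp_apply, LinearMap.id_apply] at this
    rw [map_sub, this, sub_self]
  have hT : ∀ z, coevWith F (b ∘ₗ s) (lin F c z) = coevWith F b z := by
    intro z
    rw [coevWith_lin, hbs]
  refine ⟨_, b ∘ₗ s, ?_, ?_⟩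
  · rw [injective_iff_map_eq_zero]
    intro q hq
    obtain ⟨z, rfl⟩ := lin_surjective F c q
    rw [hT, ← LinearMap.mem_ker, ← hi] at hq
    obtain ⟨x, rfl⟩ := hq
    rw [← lin_comp_apply, Limits.cokernel.condition, lin_zero, LinearMap.zero_apply]
  · refine hb.trans ?_
    rintro _ ⟨z, rfl⟩
    exact ⟨lin F c z, hT z⟩

omit [Abelian C] [Linear K C] [F.Additive] [F.Linear K] [Limits.PreservesFiniteLimits F]
  [Limits.PreservesFiniteColimits F] in
-- By flatness over `K` the identity may be checked after applying the injective comodule map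
-- `coevWith F b`, where it becomes coassociativity of `V`.
theorem coev_comp_of_coevWith_comp (V : FDComod.{t} K (EndDual F)) {Q : C}
    {b : F.obj Q →ₗ[K] V.space} (hb : Function.Injective (coevWith F b))
    (j : V.space →ₗ[K] F.obj Q) (hj : coevWith F b ∘ₗ j = V.coact) :
    coev F Q ∘ₗ j = LinearMap.lTensor (EndDual F) j ∘ₗ V.coact := by
  have hflat : Function.Injective (LinearMap.lTensor (EndDual F) (coevWith F b)) :=
    Module.Flat.lTensor_preserves_injective_linearMap _ hb
  refine LinearMap.ext fun v => hflat ?_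
  have h1 : LinearMap.lTensor (EndDual F) V.coact (V.coact v) =
      TensorProduct.assoc K (EndDual F) (EndDual F) V.space
        (LinearMap.rTensor V.space (Coalgebra.comul (R := K) (A := EndDual F)) (V.coact v)) :=
    LinearMap.congr_fun V.coassoc v
  have h2 : coevWith F b (j v) = V.coact v := LinearMap.congr_fun hj v
  have h3 := LinearMap.lTensor_comp_apply (EndDual F) (coevWith F b) j (V.coact v)
  rw [hj, h1, ← h2] at h3
  exact (lTensor_coevWith_coev F b (j v)).trans (h3.trans (by rw [h2]; rfl))

/-- Every finite-dimensional comodule embeds into some `F(Q)`. -/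
theorem exists_embedding (V : FDComod.{t} K (EndDual F)) :
    ∃ (Q : C) (j : V.space →ₗ[K] F.obj Q), Function.Injective j ∧
      coev F Q ∘ₗ j = LinearMap.lTensor (EndDual F) j ∘ₗ V.coact := by
  obtain ⟨Q, b, hinj, hrange⟩ := exists_coevWith_injective F V.coact
  -- `r` is only a linear retraction, but the coaction lands in the range of `coevWith F b`, so `r
  -- ∘ₗ V.coact` is the unique factorization through it.
  obtain ⟨r, hr⟩ := (coevWith F b).exists_leftInverse_of_injective (LinearMap.ker_eq_bot.2 hinj)
  have hj : coevWith F b ∘ₗ r ∘ₗ V.coact = V.coact := by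
    ext v
    obtain ⟨q, hq⟩ := hrange ⟨v, rfl⟩
    have := LinearMap.congr_fun hr q
    rw [LinearMap.comp_apply, LinearMap.id_apply] at this
    rw [LinearMap.comp_apply, LinearMap.comp_apply, ← hq, this]
  refine ⟨Q, r ∘ₗ V.coact, ?_, coev_comp_of_coevWith_comp F V hinj _ hj⟩
  refine Function.Injective.of_comp (f := coevWith F b) ?_
  rw [← LinearMap.coe_comp, hj]
  exact V.coact_injective

/-- A subcomodule of `F(Q)` comes from a subobject of `Q`. -/
theorem exists_range_eq_range {V : Type*} [AddCommGroup V] [Module K V]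
    {ρ : V →ₗ[K] EndDual F ⊗[K] V} {Q : C} {j : V →ₗ[K] F.obj Q}
    (hcomm : coev F Q ∘ₗ j = LinearMap.lTensor (EndDual F) j ∘ₗ ρ) :
    ∃ (I : C) (i : I ⟶ Q), Mono i ∧ LinearMap.range (lin F i) = LinearMap.range j := by
  -- This inclusion expresses that the range of `j` is a subcomodule; the reverse one follows from
  -- the counit.
  have hle : LinearMap.range j ≤ LinearMap.ker (coevWith F (LinearMap.range j).mkQ) := by
    rw [LinearMap.range_le_ker_iff, coevWith, LinearMap.comp_assoc, hcomm,
      ← LinearMap.comp_assoc, ← LinearMap.lTensor_comp, LinearMap.range_mkQ_comp,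
      LinearMap.lTensor_zero, LinearMap.zero_comp]
  obtain ⟨I, i, hmono, hi⟩ := exists_range_eq_ker_coevWith F (LinearMap.range j).mkQ
  refine ⟨I, i, hmono, le_antisymm (fun x hx => ?_) (hle.trans hi.ge)⟩
  rw [hi, LinearMap.mem_ker] at hx
  rw [← (LinearMap.range j).ker_mkQ]
  exact eq_zero_of_coevWith_eq_zero F hx

omit [Abelian C] [Linear K C] [F.Additive] [F.Linear K] [Limits.PreservesFiniteLimits F]
  [Limits.PreservesFiniteColimits F] in
-- By flatness it suffices to compare after the injection `j`, where the claim is naturality of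
-- `coev` along `i`.
theorem coact_comp_of_comp_eq_lin (V : FDComod.{t} K (EndDual F)) {I Q : C} (i : I ⟶ Q)
    {j : V.space →ₗ[K] F.obj Q} (hj : Function.Injective j)
    (hcomm : coev F Q ∘ₗ j = LinearMap.lTensor (EndDual F) j ∘ₗ V.coact)
    (e : F.obj I →ₗ[K] V.space) (he : j ∘ₗ e = lin F i) :
    V.coact ∘ₗ e = LinearMap.lTensor (EndDual F) e ∘ₗ coev F I := by
  have hflat : Function.Injective (LinearMap.lTensor (EndDual F) j) :=
    Module.Flat.lTensor_preserves_injective_linearMap _ hj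
  refine LinearMap.ext fun x => hflat ?_
  have h1 : coev F Q (j (e x)) = LinearMap.lTensor (EndDual F) j (V.coact (e x)) :=
    LinearMap.congr_fun hcomm (e x)
  have h2 : j (e x) = lin F i x := LinearMap.congr_fun he x
  have h3 := LinearMap.lTensor_comp_apply (EndDual F) j e (coev F I x)
  rw [he, ← coev_naturality, ← h2, h1] at h3
  exact h3

theorem exists_liftObj_iso (V : FDComod.{t} K (EndDual F)) :
    ∃ X : C, Nonempty (liftObj F X ≅ V) := by
  obtain ⟨Q, j, hj, hcomm⟩ := exists_embedding F V
  obtain ⟨I, i, _, hrange⟩ := exists_range_eq_range F hcomm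
  let e : F.obj I ≃ₗ[K] V.space := (LinearEquiv.ofInjective _ (lin_injective F i)).trans
    ((LinearEquiv.ofEq _ _ hrange).trans (LinearEquiv.ofInjective j hj).symm)
  have he : j ∘ₗ e.toLinearMap = lin F i :=
    LinearMap.ext fun x => congrArg Subtype.val ((LinearEquiv.ofInjective j hj).apply_symm_apply
      (LinearEquiv.ofEq _ _ hrange (LinearEquiv.ofInjective _ (lin_injective F i) x)))
  exact ⟨I, ⟨FDComod.isoOfLinearEquiv (V := liftObj F I) e
    (coact_comp_of_comp_eq_lin F V i hj hcomm e.toLinearMap he)⟩⟩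

end EndDual

theorem mainTheorem2 {K : Type u} [Field K] {C : Type w} [Category.{v} C] [Abelian C]
    [Linear K C] (F : C ⥤ FGModuleCat.{t} K) [F.Additive] [F.Linear K] [F.Faithful]
    [Limits.PreservesFiniteLimits F] [Limits.PreservesFiniteColimits F] :
    (EndDual.lift F).IsEquivalence := by
  have : (EndDual.lift F).Faithful :=
    ⟨fun h => F.map_injective (congrArg FDComod.Hom.map h)⟩
  have : (EndDual.lift F).Full := by
    refine ⟨fun h => ?_⟩
    obtain ⟨f, hf⟩ := EndDual.exists_lin_eq_of_coev_comp F h.map.hom.hom h.comm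
    exact ⟨f, FDComod.Hom.ext (FGModuleCat.hom_ext hf)⟩
  have : (EndDual.lift F).EssSurj := ⟨fun V => EndDual.exists_liftObj_iso F V⟩
  exact { }
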